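/- Let $\Bbbk$ be a field. Graphs may have loops and parallel edges; a loop is a cycle of length $1$ and two parallel edges form a cycle of length $2$. A block of a graph is a maximal nonseparable subgraph, where a graph is nonseparable if it is connected and its edge set cannot be partitioned into two nonempty classes such that at most one vertex is incident with edges of both classes. A cactus graph is a finite connected graph in which every block is either a cycle or a single edge. The cycle matroid $M(G)$ of a graph $G$ has the edge set $E_G$ as ground set, and its independent sets are the sets of edges that contain no cycle of $G$. Let $S=\Bbbk[x_e : e\in E_G]$ and $\mathfrak m=\langle x_e : e\in E_G\rangle$. The facet ideal of $M(G)$ is the ideal $\mathcal F(M(G))=\langle \prod_{e\in B}x_e : B \text{ a basis of } M(G)\rangle$ of $S$. A minimal (ungraded) free resolution of an $S$-module $N$ is a complex $0\leftarrow F_0\xleftarrow{\phi_1}F_1\xleftarrow{\phi_2}F_2\leftarrow\cdots$ of finitely generated free $S$-modules that is exact except at $F_0$, with $F_0/\operatorname{im}\phi_1\cong N$ and $\operatorname{im}\phi_i\subseteq\mathfrak m F_{i-1}$ for all $i\ge 1$. **Theorem.** Let $G$ be a cactus graph, and let $C_1,\dots,C_t$, $t\ge 1$, be all its cycles, with $C_v$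 of length $n_v$. Let $\sigma_j=\sum_{1\le k_1<\cdots<k_j\le t}n_{k_1}\cdots n_{k_j}$ (with $\sigma_0=1$) be the elementary symmetric polynomials in $n_1,\dots,n_t$. Then the $S$-module $\mathcal F(M(G))$ has a minimal free resolution of the form $$0\leftarrow S^{\beta_0}\leftarrow S^{\beta_1}\leftarrow\cdots\leftarrow S^{\beta_t}\leftarrow 0,$$ where, for $0\le i\le t$, $$\beta_i=\sum_{j=0}^{i}(-1)^j\binom{t-j}{i-j}\sigma_{t-j}=\sum_{\substack{\Sigma\subseteq\{1,\dots,t\}\\ |\Sigma|=i}}\ \prod_{v\in\Sigma}(n_v-1)\prod_{v\notin\Sigma}n_v .$$ (If $G$ has loops, the last of these ranks may be $0$.) -/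

import Mathlib

namespace Graph

open scoped Graph

variable {α β : Type*}

/-! ### Connected multigraphs, cycles, blocks, cacti

Multigraphs may have loops and parallel edges. A subgraph of `G` is a graph `H` with `H ≤ G`. -/

/-- A multigraph is connected if it has a vertex and any two of its vertices are joined by a
sequence of successively adjacent vertices. -/
def IsConnectedGraph (G : Graph α β) : Prop :=
  V(G).Nonempty ∧ ∀ x ∈ V(G), ∀ y ∈ V(G), Relation.ReflTransGen G.Adj x y

/-- `C` is a cycle of length `n ≥ 1`: its vertices are `n` distinct vertices `v 0, …, v (n - 1)`
and its edges are `n` distinct edges `e 0, …, e (n - 1)`, where `e i` joins `v i` to `v (i + 1)`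
(indices modulo `n`). A loop is a cycle of length `1`, two parallel edges form a cycle of
length `2`. -/
def IsCycleOfLength (C : Graph α β) (n : ℕ) : Prop :=
  n ≠ 0 ∧ ∃ (v : ZMod n → α) (e : ZMod n → β),
    Function.Injective v ∧ Function.Injective e ∧
    Set.range v = V(C) ∧ Set.range e = E(C) ∧ ∀ i, C.IsLink (e i) (v i) (v (i + 1))

/-- `C` is a cycle (of some length). -/
def IsCycleGraph (C : Graph α β) : Prop := ∃ n, C.IsCycleOfLength n

/-- A multigraph is nonseparable if it is connected and its edges cannot be divided into two
nonempty classes such that at most one vertex is incident with edges of both classes. -/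
def IsNonseparable (H : Graph α β) : Prop :=
  H.IsConnectedGraph ∧
    ¬ ∃ A B : Set β, A.Nonempty ∧ B.Nonempty ∧ Disjoint A B ∧ A ∪ B = E(H) ∧
      {x | (∃ e ∈ A, H.Inc e x) ∧ ∃ f ∈ B, H.Inc f x}.Subsingleton

/-- A block of `G` is a maximal nonseparable subgraph of `G`. -/
def IsBlock (G B : Graph α β) : Prop :=
  Maximal (fun H : Graph α β => H ≤ G ∧ H.IsNonseparable) B

/-- A cactus graph is a finite connected multigraph each of whose blocks is either a cycle or a
single edge. -/
structure IsCactus (G : Graph α β) : Prop where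
  finite_vertexSet : V(G).Finite
  finite_edgeSet : E(G).Finite
  connected : G.IsConnectedGraph
  isCycle_or_edge_of_isBlock : ∀ B, G.IsBlock B → B.IsCycleGraph ∨ ∃ e, E(B) = {e}

/-! ### The cycle matroid -/

/-- A set of edges of `G` is acyclic if it does not contain the edge set of a cycle of `G`. -/
def IsAcyclicSet (G : Graph α β) (I : Set β) : Prop :=
  I ⊆ E(G) ∧ ∀ C ≤ G, C.IsCycleGraph → ¬ E(C) ⊆ I

/-- The incidence vector modulo two of an edge (auxiliary, for the matroid axioms). -/
noncomputable def incVec (G : Graph α β) (e : β) : α →₀ ZMod 2 :=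
  open Classical in
  if h : ∃ p : α × α, G.IsLink e p.1 p.2 then
    Finsupp.single h.choose.1 1 + Finsupp.single h.choose.2 1 else 0

lemma IsLink.incVec_eq {G : Graph α β} {e : β} {x y : α} (h : G.IsLink e x y) :
    G.incVec e = Finsupp.single x 1 + Finsupp.single y 1 := by
  have hex : ∃ p : α × α, G.IsLink e p.1 p.2 := ⟨(x, y), h⟩
  unfold incVec
  rw [dif_pos hex]
  rcases hex.choose_spec.eq_and_eq_or_eq_and_eq h with ⟨h1, h2⟩ | ⟨h1, h2⟩
  · rw [h1, h2]
  · rw [h1, h2, add_comm]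

lemma IsCycleOfLength.exists_sum_incVec {G C : Graph α β} {n : ℕ} (hCG : C ≤ G)
    (hC : C.IsCycleOfLength n) :
    ∃ s : Finset β, s.Nonempty ∧ (s : Set β) = E(C) ∧ ∑ e ∈ s, G.incVec e = 0 := by
  classical
  obtain ⟨hn, v, e, -, he, -, hE, hl⟩ := hC
  have : NeZero n := ⟨hn⟩
  refine ⟨Finset.univ.image e, ⟨e 0, by simp⟩, by simpa using hE, ?_⟩
  rw [Finset.sum_image (fun a _ b _ h => he h)]
  have h1 : ∀ i, G.incVec (e i) = Finsupp.single (v i) 1 + Finsupp.single (v (i + 1)) 1 :=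
    fun i => ((hl i).mono hCG).incVec_eq
  simp_rw [h1]
  have h2 : ∑ i, Finsupp.single (v (i + 1)) (1 : ZMod 2) = ∑ i, Finsupp.single (v i) 1 :=
    Equiv.sum_comp (Equiv.addRight (1 : ZMod n)) (fun i => Finsupp.single (v i) (1 : ZMod 2))
  rw [Finset.sum_add_distrib, h2]
  ext z
  simp [CharTwo.add_self_eq_zero]

/-- The graph on `α` whose edges are the pairs of distinct vertices joined by an edge in `I`. -/
def linkGraph (G : Graph α β) (I : Set β) : SimpleGraph α where
  Adj x y := x ≠ y ∧ ∃ f ∈ I, G.IsLink f x y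
  symm := ⟨fun _ _ h => ⟨h.1.symm, h.2.imp fun _ hf => ⟨hf.1, hf.2.symm⟩⟩⟩
  loopless := ⟨fun _ h => h.1 rfl⟩

lemma exists_isCycleGraph_of_reachable {G : Graph α β} {I : Set β} {e : β} {x y : α}
    (he : G.IsLink e x y) (heI : e ∉ I) (h : (G.linkGraph I).Reachable x y) :
    ∃ C ≤ G, C.IsCycleGraph ∧ E(C) ⊆ insert e I := by
  classical
  obtain ⟨p, hp⟩ := h.exists_isPath
  set l := p.length with hl
  have hf : ∀ i : ℕ, ∃ f, (i < l → f ∈ I ∧ G.IsLink f (p.getVert i) (p.getVert (i + 1))) ∧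
      (l ≤ i → f = e) := by
    intro i
    by_cases hi : i < l
    · obtain ⟨-, f, hf⟩ := p.adj_getVert_succ hi
      exact ⟨f, fun _ => hf, fun h => absurd hi (by omega)⟩
    · exact ⟨e, fun h => absurd h hi, fun _ => rfl⟩
  choose f hf1 hf2 using hf
  have hinj := hp.getVert_injOn
  let v : ZMod (l + 1) → α := fun i => p.getVert i.val
  let g : ZMod (l + 1) → β := fun i => f i.val
  have hlt : ∀ i : ZMod (l + 1), i.val < l + 1 := fun i => ZMod.val_lt i
  have hv : Function.Injective v := by
    intro i j hij
    have := hlt i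
    have := hlt j
    refine ZMod.val_injective _ (hinj ?_ ?_ hij) <;> simp <;> omega
  have hlink : ∀ i, G.IsLink (g i) (v i) (v (i + 1)) := by
    intro i
    have h1 := hlt i
    have hs : (i + 1).val = (i.val + 1) % (l + 1) := by
      rw [ZMod.val_add]
      rcases Nat.eq_zero_or_pos l with h0 | h0
      · simp [h0, Nat.mod_one]
      · rw [ZMod.val_one'' (by omega)]
    by_cases hi : i.val < l
    · have := (hf1 _ hi).2
      simp only [g, v, hs]
      rwa [Nat.mod_eq_of_lt (by omega)]
    · have hil : i.val = l := by omega
      simp only [g, v, hs]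
      rw [hf2 _ (by omega), hil, Nat.mod_self, p.getVert_zero, hl, p.getVert_length]
      exact he.symm
  have hg : Function.Injective g := by
    intro i j hij
    have h1 := hlt i
    have h2 := hlt j
    apply ZMod.val_injective
    by_cases hi : i.val < l <;> by_cases hj : j.val < l
    · have hi' := (hf1 _ hi).2
      have hj' := (hf1 _ hj).2
      simp only [g] at hij
      rw [hij] at hi'
      rcases hi'.eq_and_eq_or_eq_and_eq hj' with ⟨h3, -⟩ | ⟨h3, h4⟩
      · exact hinj (by simp; omega) (by simp; omega) h3
      · have h3 := hinj (by simp; omega) (by simp; omega) h3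
        have h4 := hinj (by simp; omega) (by simp; omega) h4
        omega
    · have h3 : f i.val = e := hij.trans (hf2 j.val (by omega))
      exact absurd (h3 ▸ (hf1 _ hi).1) heI
    · have h3 : f j.val = e := hij.symm.trans (hf2 i.val (by omega))
      exact absurd (h3 ▸ (hf1 _ hj).1) heI
    · omega
  refine ⟨{ vertexSet := Set.range v
            IsLink := fun b a c => b ∈ Set.range g ∧ G.IsLink b a c
            edgeSet := Set.range g
            isLink_symm := fun b _ => ⟨fun a c h => ⟨h.1, h.2.symm⟩⟩
            eq_or_eq_of_isLink_of_isLink := fun b a c a' c' h h' => h.2.left_eq_or_eq h'.2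
            edge_mem_iff_exists_isLink := ?_
            left_mem_of_isLink := ?_ }, ⟨?_, ?_⟩, ?_, ?_⟩
  · intro b
    constructor
    · rintro ⟨i, rfl⟩
      exact ⟨_, _, ⟨i, rfl⟩, hlink i⟩
    · rintro ⟨_, _, h, _⟩
      exact h
  · rintro _ a c ⟨⟨i, rfl⟩, h⟩
    rcases h.left_eq_or_eq (hlink i) with rfl | rfl
    · exact ⟨_, rfl⟩
    · exact ⟨_, rfl⟩
  · rintro _ ⟨i, rfl⟩
    exact (hlink i).left_mem
  · intro b a c h
    exact h.2
  · exact ⟨l + 1, by omega, v, g, hv, hg, rfl, rfl, fun i => ⟨⟨i, rfl⟩, hlink i⟩⟩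
  · rintro _ ⟨i, rfl⟩
    by_cases hi : i.val < l
    · exact Or.inr (hf1 _ hi).1
    · exact Or.inl (hf2 _ (by omega))

lemma isAcyclicSet_iff {G : Graph α β} {I : Set β} :
    G.IsAcyclicSet I ↔ I ⊆ E(G) ∧ LinearIndepOn (ZMod 2) G.incVec I := by
  classical
  refine and_congr_right fun hI => ⟨fun h => ?_, ?_⟩
  · rw [linearIndepOn_iff_notMem_span]
    intro e heI hspan
    obtain ⟨x, y, hxy⟩ := exists_isLink_of_mem_edgeSet (hI heI)
    by_cases hr : (G.linkGraph (I \ {e})).Reachable x y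
    · obtain ⟨C, hCG, hC, hCI⟩ := exists_isCycleGraph_of_reachable hxy (by simp) hr
      refine h C hCG hC (hCI.trans ?_)
      rintro b (rfl | hb)
      · exact heI
      · exact hb.1
    · let φ : (α →₀ ZMod 2) →ₗ[ZMod 2] ZMod 2 := Finsupp.linearCombination (ZMod 2)
        (fun z => if (G.linkGraph (I \ {e})).Reachable x z then (1 : ZMod 2) else 0)
      have hle : Submodule.span (ZMod 2) (G.incVec '' (I \ {e})) ≤ LinearMap.ker φ := by
        rw [Submodule.span_le]
        rintro _ ⟨f, hf, rfl⟩
        obtain ⟨a, c, hac⟩ := exists_isLink_of_mem_edgeSet (hI hf.1)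
        have hiff : (G.linkGraph (I \ {e})).Reachable x a ↔
            (G.linkGraph (I \ {e})).Reachable x c := by
          by_cases hne : a = c
          · rw [hne]
          · have : (G.linkGraph (I \ {e})).Reachable a c :=
              SimpleGraph.Adj.reachable ⟨hne, f, hf, hac⟩
            exact ⟨fun h => h.trans this, fun h => h.trans this.symm⟩
        simp only [SetLike.mem_coe, LinearMap.mem_ker]
        rw [hac.incVec_eq]
        simp [φ, hiff, CharTwo.add_self_eq_zero]
      have := hle hspan
      rw [LinearMap.mem_ker, hxy.incVec_eq] at this
      simp [φ, hr] at this
  · rintro h C hCG ⟨n, hC⟩ hCI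
    obtain ⟨s, ⟨b, hb⟩, hs, hsum⟩ := hC.exists_sum_incVec hCG
    rw [linearIndepOn_iff'] at h
    have := h s (fun _ => 1) (hs ▸ hCI) (by simpa using hsum) b hb
    exact one_ne_zero this

/-- The cycle matroid of a multigraph: its ground set is the edge set, and its independent sets
are the acyclic sets of edges. -/
noncomputable def cycleMatroid (G : Graph α β) : Matroid β :=
  IndepMatroid.matroid <| IndepMatroid.ofFinitaryCardAugment E(G) G.IsAcyclicSet
    (by rw [isAcyclicSet_iff]; exact ⟨Set.empty_subset _, linearIndepOn_empty _ _⟩)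
    (fun _ _ hJ hIJ => ⟨hIJ.trans hJ.1, fun C hC hC' h => hJ.2 C hC hC' (h.trans hIJ)⟩)
    (by
      intro I J hI hIf hJ hJf hlt
      simp only [isAcyclicSet_iff] at hI hJ ⊢
      by_contra! hcon
      have hsub : ∀ e ∈ J, G.incVec e ∈ Submodule.span (ZMod 2) (G.incVec '' I) := by
        intro e heJ
        by_contra hspan
        by_cases heI : e ∈ I
        · exact hspan (Submodule.subset_span ⟨e, heI, rfl⟩)
        · exact hcon e heJ heI (Set.insert_subset (hJ.1 heJ) hI.1) (hI.2.insert hspan)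
      have h1 : Module.finrank (ZMod 2) (Submodule.span (ZMod 2) (G.incVec '' J)) = J.ncard := by
        have := hJf.fintype
        rw [Set.image_eq_range, finrank_span_eq_card hJ.2.linearIndependent,
          Set.ncard_eq_toFinset_card', Set.toFinset_card]
      have h2 : Module.finrank (ZMod 2) (Submodule.span (ZMod 2) (G.incVec '' I)) = I.ncard := by
        have := hIf.fintype
        rw [Set.image_eq_range, finrank_span_eq_card hI.2.linearIndependent,
          Set.ncard_eq_toFinset_card', Set.toFinset_card]
      have hfin : FiniteDimensional (ZMod 2) (Submodule.span (ZMod 2) (G.incVec '' I)) :=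
        FiniteDimensional.span_of_finite _ (hIf.image _)
      have hle := Submodule.finrank_mono (Submodule.span_le.2 (by
        rintro _ ⟨e, he, rfl⟩
        exact hsub e he) : Submodule.span (ZMod 2) (G.incVec '' J) ≤
          Submodule.span (ZMod 2) (G.incVec '' I))
      omega)
    (by
      intro I h
      refine ⟨fun e he => (h {e} (by simpa using he) (Set.finite_singleton e)).1 rfl, ?_⟩
      rintro C hCG ⟨n, hC⟩ hCI
      obtain ⟨s, -, hs, -⟩ := hC.exists_sum_incVec hCG
      exact (h E(C) hCI (hs ▸ s.finite_toSet)).2 C hCG ⟨n, hC⟩ subset_rfl)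
    (fun _ h => h.1)

@[simp] lemma cycleMatroid_ground (G : Graph α β) : G.cycleMatroid.E = E(G) := rfl

@[simp] lemma cycleMatroid_indep (G : Graph α β) (I : Set β) :
    G.cycleMatroid.Indep I ↔ G.IsAcyclicSet I := Iff.rfl

end Graph

/-- The facet ideal of a (finite) matroid `M` over `k`: the ideal of the polynomial ring with one
variable for each element of `M`, generated by the square-free monomials `∏ e ∈ B, x_e` with `B` a
basis of `M` (the bases being the facets of the complex of independent sets). -/
noncomputable def Matroid.facetIdeal {β : Type*} (k : Type*) [Field k] (M : Matroid β) :
    Ideal (MvPolynomial M.E k) :=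
  Ideal.span {p | ∃ B : Finset M.E, M.IsBase (Subtype.val '' (B : Set M.E)) ∧
    p = ∏ e ∈ B, MvPolynomial.X e}

/-- The ideal of `k[x_i : i ∈ ι]` generated by all the variables. -/
noncomputable def MvPolynomial.variableIdeal (ι k : Type*) [Field k] : Ideal (MvPolynomial ι k) :=
  Ideal.span (Set.range MvPolynomial.X)

/-- The `S`-module `N` has a free resolution
`0 ← N ← S ^ b 0 ← S ^ b 1 ← S ^ b 2 ← ⋯` (exact everywhere) which is minimal with respect to the
ideal `m`: the image of each `S ^ b (i + 1) → S ^ b i` lies in `m • S ^ b i`. -/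
def HasMinimalFreeResolution {S : Type*} [CommRing S] (m : Ideal S) (N : Type*) [AddCommGroup N]
    [Module S N] (b : ℕ → ℕ) : Prop :=
  ∃ (ε : (Fin (b 0) → S) →ₗ[S] N) (d : ∀ i, (Fin (b (i + 1)) → S) →ₗ[S] (Fin (b i) → S)),
    Function.Surjective ε ∧
    LinearMap.range (d 0) = LinearMap.ker ε ∧
    (∀ i, LinearMap.range (d (i + 1)) = LinearMap.ker (d i)) ∧
    ∀ i, LinearMap.range (d i) ≤ m • (⊤ : Submodule S (Fin (b i) → S))

/-- The `j`-th elementary symmetric polynomial in `n 0, …, n (t - 1)`. -/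
def elemSymm {t : ℕ} (n : Fin t → ℕ) (j : ℕ) : ℕ :=
  ∑ A ∈ Finset.powersetCard j Finset.univ, ∏ v ∈ A, n v

/-! In a cactus any two distinct cycles are edge-disjoint. If they shared an edge, they would lie in
one nonseparable subgraph, hence in one block; that block is a cycle or a single edge, and all
cycles inside it have the same edge set (`IsCactus.disjoint_edgeSet`). So the minimal dependent sets
of `M(G)` are the disjoint edge sets `E_v` of the cycles, and a basis is obtained by deleting one
edge from each of them. The facet ideal therefore factors as `(∏ x_e : e in no cycle) * ∏ J_v`,
where `J_v` is generated by the products of all but one of the variables of `E_v`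
(`Matroid.facetIdeal_eq`).

For `n` pairwise non-associated primes, the syzygies of the `n` products of all but one of them are
free of rank `n - 1` (`injective_syzygyMap`, `exists_syzygyMap_eq`), so `J_v` has the resolution `0
← S^n ← S^(n-1) ← 0` with `n = n_v`. The factors involve disjoint sets of variables, so the tensor
product of their resolutions resolves the product ideal. It is built one factor at a time
(`Ideal.HasMinimalResolution.mul_span_prodErase`): each step only needs the new variables to be
nonzerodivisors modulo the monomial ideal already resolved. All matrix entries stay in the ideal of
the variables, so minimality persists.

The ranks are thus the coefficients of `∏ (n_v + (n_v - 1) X)`. Expanding it directly gives the sum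
over subsets; rewriting each factor as `-X + n_v (1 + X)` gives the alternating sum. -/

section Resolution

/-! ### Minimal resolutions of ideals by finite free modules -/

variable {S : Type*} [CommRing S]

/-- `b` are the ranks of a free resolution of the ideal `I` that is minimal with respect to `m`,
with the augmentation regarded as a map into the ring. -/
def Ideal.HasMinimalResolution (m I : Ideal S) (b : ℕ → ℕ) : Prop :=
  ∃ (ε : (Fin (b 0) → S) →ₗ[S] S) (d : ∀ i, (Fin (b (i + 1)) → S) →ₗ[S] (Fin (b i) → S)),
    LinearMap.range ε = I ∧
    LinearMap.range (d 0) = LinearMap.ker ε ∧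
    (∀ i, LinearMap.range (d (i + 1)) = LinearMap.ker (d i)) ∧
    ∀ i, LinearMap.range (d i) ≤ m • (⊤ : Submodule S (Fin (b i) → S))

lemma Ideal.HasMinimalResolution.hasMinimalFreeResolution {m I : Ideal S} {b : ℕ → ℕ}
    (h : m.HasMinimalResolution I b) : HasMinimalFreeResolution m I b := by
  obtain ⟨ε, d, rfl, h0, h1, h2⟩ := h
  refine ⟨ε.rangeRestrict, d, ε.surjective_rangeRestrict, ?_, h1, h2⟩
  rw [h0, LinearMap.ker_rangeRestrict]

lemma LinearMap.map_smul_top_le (m : Ideal S) {M N : Type*} [AddCommGroup M] [Module S M]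
    [AddCommGroup N] [Module S N] (f : M →ₗ[S] N) {P : Submodule S M}
    (hP : P ≤ m • (⊤ : Submodule S M)) : P.map f ≤ m • (⊤ : Submodule S N) := by
  refine (Submodule.map_mono hP).trans ?_
  rw [Submodule.map_smul'']
  exact Submodule.smul_mono le_rfl le_top

lemma LinearMap.range_linearEquiv_conj {A B A' B' : Type*} [AddCommGroup A] [AddCommGroup B]
    [AddCommGroup A'] [AddCommGroup B'] [Module S A] [Module S B] [Module S A'] [Module S B']
    (f : A →ₗ[S] B) (a : A ≃ₗ[S] A') (c : B ≃ₗ[S] B') :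
    range (c.toLinearMap ∘ₗ f ∘ₗ a.symm.toLinearMap) = (range f).map c.toLinearMap := by
  rw [LinearMap.range_comp, LinearEquiv.range_comp]

lemma LinearMap.ker_linearEquiv_conj {A B A' B' : Type*} [AddCommGroup A] [AddCommGroup B]
    [AddCommGroup A'] [AddCommGroup B'] [Module S A] [Module S B] [Module S A'] [Module S B']
    (f : A →ₗ[S] B) (a : A ≃ₗ[S] A') (c : B ≃ₗ[S] B') :
    ker (c.toLinearMap ∘ₗ f ∘ₗ a.symm.toLinearMap) = (ker f).map a.toLinearMap := by
  rw [LinearEquiv.ker_comp, LinearMap.ker_comp, Submodule.map_equiv_eq_comap_symm]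

/-- A minimal resolution may be given by arbitrary finite free modules: `M₀` in degree `0` and
`M i` in degree `i + 1`. -/
lemma Ideal.HasMinimalResolution.of_free [Nontrivial S] {m I : Ideal S} {b : ℕ → ℕ}
    {M₀ : Type*} [AddCommGroup M₀] [Module S M₀] [Module.Free S M₀] [Module.Finite S M₀]
    {M : ℕ → Type*} [∀ i, AddCommGroup (M i)] [∀ i, Module S (M i)] [∀ i, Module.Free S (M i)]
    [∀ i, Module.Finite S (M i)]
    (hb₀ : Module.finrank S M₀ = b 0) (hb : ∀ i, Module.finrank S (M i) = b (i + 1))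
    (ε : M₀ →ₗ[S] S) (d₀ : M 0 →ₗ[S] M₀) (d : ∀ i, M (i + 1) →ₗ[S] M i)
    (hε : LinearMap.range ε = I) (h₀ : LinearMap.range d₀ = LinearMap.ker ε)
    (h₁ : LinearMap.range (d 0) = LinearMap.ker d₀)
    (h : ∀ i, LinearMap.range (d (i + 1)) = LinearMap.ker (d i))
    (hm₀ : LinearMap.range d₀ ≤ m • (⊤ : Submodule S M₀))
    (hm : ∀ i, LinearMap.range (d i) ≤ m • (⊤ : Submodule S (M i))) :
    m.HasMinimalResolution I b := by
  have e₀ : M₀ ≃ₗ[S] (Fin (b 0) → S) := LinearEquiv.ofFinrankEq _ _ (by simpa using hb₀)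
  have e : ∀ i, M i ≃ₗ[S] (Fin (b (i + 1)) → S) := fun i =>
    LinearEquiv.ofFinrankEq _ _ (by simpa using hb i)
  refine ⟨ε ∘ₗ e₀.symm.toLinearMap, fun i => match i with
    | 0 => e₀.toLinearMap ∘ₗ d₀ ∘ₗ (e 0).symm.toLinearMap
    | i + 1 => (e i).toLinearMap ∘ₗ d i ∘ₗ (e (i + 1)).symm.toLinearMap, ?_, ?_, ?_, ?_⟩
  · rw [LinearEquiv.range_comp, hε]
  · rw [LinearMap.range_linearEquiv_conj, h₀, LinearMap.ker_comp, Submodule.map_equiv_eq_comap_symm]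
  · rintro (_ | i)
    · exact (LinearMap.range_linearEquiv_conj _ _ _).trans (by rw [h₁]; exact (LinearMap.ker_linearEquiv_conj _ _ _).symm)
    · exact (LinearMap.range_linearEquiv_conj _ _ _).trans (by rw [h]; exact (LinearMap.ker_linearEquiv_conj _ _ _).symm)
  · rintro (_ | i)
    · exact (LinearMap.range_linearEquiv_conj _ _ _).trans_le (LinearMap.map_smul_top_le _ _ hm₀)
    · exact (LinearMap.range_linearEquiv_conj _ _ _).trans_le (LinearMap.map_smul_top_le _ _ (hm _))

lemma Ideal.mem_smul_top_pi {m : Ideal S} {M ι : Type*} [AddCommGroup M] [Module S M] [Finite ι]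
    {y : ι → M} (h : ∀ c, y c ∈ m • (⊤ : Submodule S M)) :
    y ∈ m • (⊤ : Submodule S (ι → M)) := by
  classical
  have := Fintype.ofFinite ι
  rw [← Finset.univ_sum_single y]
  refine Submodule.sum_mem _ fun c _ => ?_
  exact LinearMap.map_smul_top_le m (LinearMap.single S (fun _ : ι => M) c) le_rfl
    (Submodule.mem_map_of_mem (h c))

lemma Ideal.mem_smul_top_prod {m : Ideal S} {M N : Type*} [AddCommGroup M] [Module S M]
    [AddCommGroup N] [Module S N] {y : M × N} (h₁ : y.1 ∈ m • (⊤ : Submodule S M))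
    (h₂ : y.2 ∈ m • (⊤ : Submodule S N)) : y ∈ m • (⊤ : Submodule S (M × N)) := by
  have h : y = LinearMap.inl S M N y.1 + LinearMap.inr S M N y.2 := by ext <;> simp
  rw [h]
  exact add_mem (LinearMap.map_smul_top_le m _ le_rfl (Submodule.mem_map_of_mem h₁))
    (LinearMap.map_smul_top_le m _ le_rfl (Submodule.mem_map_of_mem h₂))

/-! ### The syzygies of the products of all but one of a family of elements -/

section Syzygy

variable {p : ℕ} (x : Fin (p + 1) → S) (M : Type*) [AddCommGroup M] [Module S M]

/-- The map sending `w` to `(x c * b c)` where `b 0, …, b p` has sum zero and `b (i + 1) = w i`. -/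
def syzygyMap : (Fin p → M) →ₗ[S] (Fin (p + 1) → M) :=
  LinearMap.pi fun c => x c •
    (Fin.cons (-∑ i, LinearMap.proj i) (fun i => LinearMap.proj i) :
      Fin (p + 1) → (Fin p → M) →ₗ[S] M) c

variable {M}

@[simp] lemma syzygyMap_zero (w : Fin p → M) : syzygyMap x M w 0 = -(x 0 • ∑ i, w i) := by
  simp [syzygyMap]

@[simp] lemma syzygyMap_succ (w : Fin p → M) (i : Fin p) :
    syzygyMap x M w i.succ = x i.succ • w i := by
  simp [syzygyMap]

/-- Naturality in the coefficient module: this is what makes the differentials of the tensor product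
below compose to zero. -/
lemma compLeft_syzygyMap {N : Type*} [AddCommGroup N] [Module S N] (f : M →ₗ[S] N)
    (w : Fin p → M) :
    f.compLeft (Fin (p + 1)) (syzygyMap x M w) = syzygyMap x N (f.compLeft (Fin p) w) := by
  ext c
  refine Fin.cases ?_ (fun i => ?_) c <;> simp

lemma syzygyMap_mem_smul_top {m : Ideal S} (hx : ∀ c, x c ∈ m) (w : Fin p → M) :
    syzygyMap x M w ∈ m • (⊤ : Submodule S (Fin (p + 1) → M)) := by
  refine Ideal.mem_smul_top_pi fun c => ?_
  refine Fin.cases ?_ (fun i => ?_) c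
  · rw [syzygyMap_zero]
    exact neg_mem (Submodule.smul_mem_smul (hx 0) trivial)
  · rw [syzygyMap_succ]
    exact Submodule.smul_mem_smul (hx _) trivial

/-- The product of all `x c'` with `c' ≠ c`. -/
def prodErase (c : Fin (p + 1)) : S := ∏ c' ∈ Finset.univ.erase c, x c'

lemma mul_prodErase (c : Fin (p + 1)) : x c * prodErase x c = ∏ c', x c' :=
  Finset.mul_prod_erase _ _ (Finset.mem_univ c)

lemma sum_syzygyMap_mul_prodErase (w : Fin p → S) :
    ∑ c, syzygyMap x S w c * prodErase x c = 0 := by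
  have h : ∀ i : Fin p, x i.succ * w i * prodErase x i.succ = w i * ∏ c', x c' := fun i => by
    rw [← mul_prodErase x i.succ]; ring
  rw [Fin.sum_univ_succ]
  simp only [syzygyMap_zero, syzygyMap_succ, smul_eq_mul, h, ← Finset.sum_mul]
  rw [← mul_prodErase x 0]
  ring

lemma injective_syzygyMap [IsDomain S] (hx : ∀ c, x c ≠ 0) :
    Function.Injective (syzygyMap x S) := by
  rw [injective_iff_map_eq_zero]
  intro w hw
  ext i
  have := congr_fun hw i.succ
  rw [syzygyMap_succ] at this
  simpa [hx] using this

/-- All terms of the relation other than the `c`-th contain the factor `x c`, so `x c` divides `a c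
* prodErase x c`; being prime and dividing no other `x c'`, it divides `a c`. Writing `a c = x c * b
c` and cancelling the product of all the `x c` leaves `∑ b c = 0`, so `b 0` is determined by the
remaining `b c`. -/
lemma exists_syzygyMap_eq [IsDomain S] (hx : ∀ c, Prime (x c))
    (hd : ∀ c c', c ≠ c' → ¬ x c ∣ x c') {a : Fin (p + 1) → S}
    (ha : ∑ c, a c * prodErase x c = 0) : ∃ w, syzygyMap x S w = a := by
  have hdvd : ∀ c, x c ∣ a c := by
    intro c
    have h1 : x c ∣ a c * prodErase x c := by
      rw [← Finset.add_sum_erase _ _ (Finset.mem_univ c)] at ha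
      rw [eq_neg_of_add_eq_zero_left ha, dvd_neg]
      refine Finset.dvd_sum fun c' hc' => Dvd.dvd.mul_left (Finset.dvd_prod_of_mem _ ?_) _
      simpa using (Finset.ne_of_mem_erase hc').symm
    refine ((hx c).dvd_or_dvd h1).resolve_right fun h2 => ?_
    obtain ⟨c', hc', h3⟩ := (hx c).exists_mem_finset_dvd h2
    exact hd c c' (Finset.ne_of_mem_erase hc').symm h3
  choose b hb using hdvd
  have hP : ∏ c', x c' ≠ 0 := Finset.prod_ne_zero_iff.2 fun c _ => (hx c).ne_zero
  have hsum : ∑ c, b c = 0 := by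
    have h : ∀ c, a c * prodErase x c = b c * ∏ c', x c' := fun c => by
      rw [hb, ← mul_prodErase x c]; ring
    simp only [h, ← Finset.sum_mul] at ha
    exact (mul_eq_zero.1 ha).resolve_right hP
  refine ⟨fun i => b i.succ, ?_⟩
  ext c
  refine Fin.cases ?_ (fun i => ?_) c
  · rw [Fin.sum_univ_succ] at hsum
    rw [syzygyMap_zero, hb 0, eq_neg_of_add_eq_zero_left hsum]
    simp
  · rw [syzygyMap_succ, hb i.succ, smul_eq_mul]

end Syzygy

/-- If the primes `x 0, …, x p` are nonzerodivisors modulo the ideal `I`, a minimal resolution of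
`I` yields one of the product of `I` with the ideal of the products of `p` of the `x c`. -/
lemma Ideal.HasMinimalResolution.mul_span_prodErase [IsDomain S] {m I : Ideal S} {b b' : ℕ → ℕ}
    (h : m.HasMinimalResolution I b) {p : ℕ} {x : Fin (p + 1) → S} (hx : ∀ c, Prime (x c))
    (hd : ∀ c c', c ≠ c' → ¬ x c ∣ x c') (hxm : ∀ c, x c ∈ m)
    (hxI : ∀ c f, x c * f ∈ I → f ∈ I) (hb₀ : b' 0 = (p + 1) * b 0)
    (hb : ∀ i, b' (i + 1) = (p + 1) * b (i + 1) + p * b i) :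
    m.HasMinimalResolution (I * Ideal.span (Set.range (prodErase x))) b' := by
  obtain ⟨ε, d, hε, h0, h1, h2⟩ := h
  have hcomp0 : ∀ u, ε (d 0 u) = 0 := fun u =>
    LinearMap.mem_ker.1 (h0 ▸ LinearMap.mem_range_self (d 0) u)
  have hcomp : ∀ i u, d i (d (i + 1) u) = 0 := fun i u =>
    LinearMap.mem_ker.1 (h1 i ▸ LinearMap.mem_range_self (d (i + 1)) u)
  -- lifting of kernels, coordinatewise
  have lift0 : ∀ {q : ℕ} (u : Fin q → Fin (b 0) → S), ε.compLeft (Fin q) u = 0 →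
      ∃ v, (d 0).compLeft (Fin q) v = u := by
    intro q u hu
    have : ∀ c, ∃ v, d 0 v = u c := fun c => by
      have : u c ∈ LinearMap.ker ε := congr_fun hu c
      rwa [← h0] at this
    choose v hv using this
    exact ⟨v, funext hv⟩
  have lift : ∀ i {q : ℕ} (u : Fin q → Fin (b (i + 1)) → S), (d i).compLeft (Fin q) u = 0 →
      ∃ v, (d (i + 1)).compLeft (Fin q) v = u := by
    intro i q u hu
    have : ∀ c, ∃ v, d (i + 1) v = u c := fun c => by
      have : u c ∈ LinearMap.ker (d i) := congr_fun hu c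
      rwa [← h1] at this
    choose v hv using this
    exact ⟨v, funext hv⟩
  have hc0 : ∀ {q : ℕ} (u : Fin q → Fin (b 1) → S),
      ε.compLeft (Fin q) ((d 0).compLeft (Fin q) u) = 0 := fun u => funext fun c => hcomp0 _
  have hc : ∀ i {q : ℕ} (u : Fin q → Fin (b (i + 2)) → S),
      (d i).compLeft (Fin q) ((d (i + 1)).compLeft (Fin q) u) = 0 :=
    fun i q u => funext fun c => hcomp _ _
  have hm' : ∀ i {q : ℕ} (u : Fin q → Fin (b (i + 1)) → S),
      (d i).compLeft (Fin q) u ∈ m • (⊤ : Submodule S (Fin q → Fin (b i) → S)) :=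
    fun i q u => Ideal.mem_smul_top_pi fun c => h2 i (LinearMap.mem_range_self _ _)
  let A : ((Fin (p + 1) → Fin (b 0) → S) →ₗ[S] S) :=
    ∑ c, prodErase x c • (ε ∘ₗ LinearMap.proj c)
  have hA : ∀ u, A u = ∑ c, ε.compLeft (Fin (p + 1)) u c * prodErase x c := fun u => by
    simp [A, mul_comm]
  have hinj := injective_syzygyMap x fun c => (hx c).ne_zero
  -- The tensor product of the given resolution `F` with `S^(p+1) ← S^p`: its degree `i` part is
  -- `F_i^(p+1) ⊕ F_(i-1)^p`, with only the first summand for `i = 0`. The sign in the second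
  -- component of `D` makes the mixed terms cancel.
  let D₀ : ((Fin (p + 1) → Fin (b 1) → S) × (Fin p → Fin (b 0) → S)) →ₗ[S]
      (Fin (p + 1) → Fin (b 0) → S) :=
    ((d 0).compLeft (Fin (p + 1))).coprod (syzygyMap x _)
  let D : ∀ i, ((Fin (p + 1) → Fin (b (i + 2)) → S) × (Fin p → Fin (b (i + 1)) → S)) →ₗ[S]
      ((Fin (p + 1) → Fin (b (i + 1)) → S) × (Fin p → Fin (b i) → S)) := fun i =>
    (((d (i + 1)).compLeft (Fin (p + 1))).coprod (syzygyMap x _)).prod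
      (-((d i).compLeft (Fin p) ∘ₗ LinearMap.snd _ _ _))
  have hD₀ : ∀ u w, D₀ (u, w) = (d 0).compLeft (Fin (p + 1)) u + syzygyMap x _ w :=
    fun u w => by simp [D₀]
  have hD : ∀ i u w, D i (u, w) = ((d (i + 1)).compLeft (Fin (p + 1)) u + syzygyMap x _ w,
    -(d i).compLeft (Fin p) w) := fun i u w => by simp [D]
  refine .of_free (M₀ := Fin (p + 1) → Fin (b 0) → S)
    (M := fun i => (Fin (p + 1) → Fin (b (i + 1)) → S) × (Fin p → Fin (b i) → S))
    ?_ ?_ A D₀ D ?_ ?_ ?_ ?_ ?_ ?_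
  · simp [Module.finrank_pi_fintype, hb₀]
  · intro i
    simp [Module.finrank_pi_fintype, hb]
  · apply le_antisymm
    · rintro _ ⟨u, rfl⟩
      rw [hA]
      refine Ideal.sum_mem _ fun c _ => Ideal.mul_mem_mul ?_ (Ideal.subset_span ⟨c, rfl⟩)
      exact hε ▸ LinearMap.mem_range_self ε (u c)
    · rw [Ideal.mul_le]
      intro r hr s hs
      rw [← hε] at hr
      obtain ⟨u, rfl⟩ := hr
      induction hs using Submodule.span_induction with
      | mem s hs =>
        obtain ⟨c, rfl⟩ := hs
        refine ⟨Pi.single c u, ?_⟩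
        rw [hA, Finset.sum_eq_single c]
        · simp
        · intro c' _ hc'
          simp [Pi.single_eq_of_ne hc']
        · simp
      | zero => simp
      | add s t _ _ hs ht => rw [mul_add]; exact add_mem hs ht
      | smul a s _ hs =>
        rw [smul_eq_mul, mul_left_comm]
        exact Submodule.smul_mem _ a hs
  · apply le_antisymm
    · rintro _ ⟨⟨u, w⟩, rfl⟩
      rw [LinearMap.mem_ker, hA, hD₀, map_add, hc0, zero_add, compLeft_syzygyMap,
        sum_syzygyMap_mul_prodErase]
    · intro u hu
      rw [LinearMap.mem_ker, hA] at hu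
      obtain ⟨a, ha⟩ := exists_syzygyMap_eq x hx hd hu
      -- The syzygy `a` has its entries in `S`; to correct `u` it must be lifted along `ε`. Here `x
      -- i.succ * a i` is a coordinate of the image of `u`, so it lies in `I`, and `x i.succ` is a
      -- nonzerodivisor modulo `I`.
      have haI : ∀ i, ∃ w, ε w = a i := fun i => by
        have h3 : x i.succ * a i ∈ I := by
          have := congr_fun ha i.succ
          rw [syzygyMap_succ, smul_eq_mul] at this
          rw [this, ← hε]
          exact LinearMap.mem_range_self ε _
        have := hxI _ _ h3
        rwa [← hε] at this
      choose w hw using haI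
      obtain ⟨v, hv⟩ := lift0 (u - syzygyMap x _ w) (by
        rw [map_sub, compLeft_syzygyMap, sub_eq_zero, ← ha]
        congr 1
        exact (funext hw).symm)
      exact ⟨(v, w), by rw [hD₀, hv, sub_add_cancel]⟩
  · apply le_antisymm
    · rintro _ ⟨⟨u, w⟩, rfl⟩
      rw [LinearMap.mem_ker, hD, hD₀, map_add, hc, zero_add, compLeft_syzygyMap, map_neg,
        add_neg_cancel]
    · rintro ⟨u, w⟩ hu
      rw [LinearMap.mem_ker, hD₀] at hu
      -- Applying `ε` coordinatewise kills the `d 0` part of the relation, so `syzygyMap` sends the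
      -- image of `w` to zero, and its injectivity puts `w` in the kernel.
      obtain ⟨w', rfl⟩ := lift0 w (by
        apply hinj
        rw [← compLeft_syzygyMap, eq_neg_of_add_eq_zero_right hu, map_neg, hc0, neg_zero,
          map_zero])
      obtain ⟨u', hu'⟩ := lift 0 (u + syzygyMap x _ w') (by
        rw [map_add, compLeft_syzygyMap, hu])
      exact ⟨(u', -w'), by rw [hD, hu', map_neg, map_neg]; simp⟩
  · intro i
    apply le_antisymm
    · rintro _ ⟨⟨u, w⟩, rfl⟩
      rw [LinearMap.mem_ker, hD, hD, map_add, hc, zero_add, compLeft_syzygyMap, map_neg, map_neg,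
        add_neg_cancel, hc]
      simp
    · rintro ⟨u, w⟩ hu
      rw [LinearMap.mem_ker, hD, Prod.mk_eq_zero, neg_eq_zero] at hu
      obtain ⟨w', rfl⟩ := lift i w hu.2
      obtain ⟨u', hu'⟩ := lift (i + 1) (u + syzygyMap x _ w') (by
        rw [map_add, compLeft_syzygyMap, hu.1])
      exact ⟨(u', -w'), by rw [hD, hu', map_neg, map_neg]; simp⟩
  · rintro _ ⟨⟨u, w⟩, rfl⟩
    rw [hD₀]
    exact add_mem (hm' _ _) (syzygyMap_mem_smul_top x hxm w)
  · rintro i _ ⟨⟨u, w⟩, rfl⟩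
    rw [hD]
    exact Ideal.mem_smul_top_prod (add_mem (hm' _ _) (syzygyMap_mem_smul_top x hxm w))
      (neg_mem (hm' _ _))

/-- A nonzero principal ideal of a domain is free of rank one. -/
lemma Ideal.HasMinimalResolution.span_singleton [IsDomain S] (m : Ideal S) {a : S} (ha : a ≠ 0)
    {b : ℕ → ℕ} (hb₀ : b 0 = 1) (hb : ∀ i, b (i + 1) = 0) :
    m.HasMinimalResolution (Ideal.span {a}) b := by
  refine .of_free (M₀ := S) (M := fun _ => PUnit) (by simp [hb₀]) (by simp [hb, Module.finrank_eq_zero_of_subsingleton])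
    (LinearMap.toSpanSingleton S S a) 0 0 ?_ ?_ ?_ ?_ ?_ ?_
  · exact (LinearMap.range_toSpanSingleton a)
  · rw [LinearMap.range_zero, eq_comm, LinearMap.ker_toSpanSingleton (R := S) ha]
  · exact Subsingleton.elim _ _
  · exact fun _ => Subsingleton.elim _ _
  · simp
  · simp

end Resolution

/-! ### Monomial ideals in disjoint sets of variables -/

section MonomialIdeal

open MvPolynomial

variable {σ k : Type*} [Field k]

/-- The ideal `I` is generated by monomials that do not involve the variable `c`. -/
def Ideal.IsMonomialAvoiding (c : σ) (I : Ideal (MvPolynomial σ k)) : Prop :=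
  ∃ s : Set (σ →₀ ℕ), (∀ a ∈ s, a c = 0) ∧ I = Ideal.span ((fun a => monomial a (1 : k)) '' s)

/-- Multiplication by `X c` raises only the exponent of `c`, on which divisibility by a generator
does not depend. Hence each monomial of `f` is already divisible by a generator. -/
lemma Ideal.IsMonomialAvoiding.mem_of_X_mul_mem {c : σ} {I : Ideal (MvPolynomial σ k)}
    (hI : I.IsMonomialAvoiding c) {f : MvPolynomial σ k} (hf : X c * f ∈ I) : f ∈ I := by
  classical
  obtain ⟨s, hs, rfl⟩ := hI
  rw [mem_ideal_span_monomial_image] at hf ⊢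
  intro a ha
  obtain ⟨b, hb, hba⟩ := hf (Finsupp.single c 1 + a) (by
    rw [mem_support_iff, coeff_X_mul]
    exact mem_support_iff.1 ha)
  refine ⟨b, hb, fun e => ?_⟩
  by_cases he : e = c
  · rw [he, hs b hb]
    exact Nat.zero_le _
  · simpa [Finsupp.single_apply, Ne.symm he] using hba e

lemma Ideal.IsMonomialAvoiding.mul {c : σ} {I J : Ideal (MvPolynomial σ k)}
    (hI : I.IsMonomialAvoiding c) (hJ : J.IsMonomialAvoiding c) : (I * J).IsMonomialAvoiding c := by
  obtain ⟨s, hs, rfl⟩ := hI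
  obtain ⟨r, hr, rfl⟩ := hJ
  refine ⟨Set.image2 (· + ·) s r, ?_, ?_⟩
  · rintro _ ⟨a, ha, b, hb, rfl⟩
    simp [hs a ha, hr b hb]
  · rw [Ideal.span_mul_span]
    congr 1
    rw [← Set.image2_mul, Set.image2_image_left, Set.image2_image_right, Set.image_image2]
    simp [monomial_mul]

lemma Ideal.isMonomialAvoiding_one (c : σ) :
    (1 : Ideal (MvPolynomial σ k)).IsMonomialAvoiding c :=
  ⟨{0}, by simp, by simp [Ideal.span_singleton_one]⟩

lemma Ideal.IsMonomialAvoiding.prod {ι : Type*} {c : σ} {A : Finset ι}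
    {I : ι → Ideal (MvPolynomial σ k)} (hI : ∀ v ∈ A, (I v).IsMonomialAvoiding c) :
    (∏ v ∈ A, I v).IsMonomialAvoiding c :=
  Finset.prod_induction _ _ (fun _ _ => .mul) (Ideal.isMonomialAvoiding_one c) hI

lemma Ideal.isMonomialAvoiding_span_range_prod_X {κ : Type*} {c : σ} (B : κ → Finset σ)
    (hB : ∀ j, c ∉ B j) : (Ideal.span (Set.range fun j =>
      (∏ e ∈ B j, X e : MvPolynomial σ k))).IsMonomialAvoiding c := by
  classical
  refine ⟨Set.range fun j => ∑ e ∈ B j, Finsupp.single e 1, ?_, ?_⟩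
  · rintro _ ⟨j, rfl⟩
    simp only [Finsupp.finsetSum_apply]
    refine Finset.sum_eq_zero fun e he => ?_
    rw [Finsupp.single_apply, if_neg]
    rintro rfl
    exact hB j he
  · rw [← Set.range_comp]
    congr 2
    ext1 j
    simp [X, monomial_sum_one]

lemma MvPolynomial.not_X_dvd_X {c c' : σ} (h : c ≠ c') :
    ¬ (X c : MvPolynomial σ k) ∣ X c' := by
  rw [X_dvd_X]
  simpa using h

/-- The ideal generated by the products of all but one of the variables in `E`. -/
noncomputable def eraseIdeal (k : Type*) [Field k] [DecidableEq σ] (E : Finset σ) :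
    Ideal (MvPolynomial σ k) :=
  Ideal.span (Set.range fun c : E => ∏ e ∈ E.erase c, X e)

/-- Induction on `A`. The factor `(p + 1) + p X` for the new index encodes the recursion of ranks in
`Ideal.HasMinimalResolution.mul_span_prodErase`. An `E v` with one element (a loop) is the case `p =
0`, where the new factor is the unit ideal. -/
lemma hasMinimalResolution_prod_eraseIdeal [DecidableEq σ] {ι : Type*} (R : Finset σ)
    (E : ι → Finset σ) (hER : ∀ v, Disjoint (E v) R)
    (hE : Pairwise fun v w => Disjoint (E v) (E w)) (hne : ∀ v, (E v).Nonempty) (A : Finset ι) :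
    (variableIdeal σ k).HasMinimalResolution
      (Ideal.span {∏ e ∈ R, X e} * ∏ v ∈ A, eraseIdeal k (E v))
      (fun i => (∏ v ∈ A, (Polynomial.C (E v).card +
        Polynomial.C ((E v).card - 1) * Polynomial.X)).coeff i) := by
  classical
  induction A using Finset.induction_on with
  | empty =>
    rw [Finset.prod_empty, mul_one]
    refine .span_singleton _ ?_ (by simp) (by simp [Polynomial.coeff_one])
    exact Finset.prod_ne_zero_iff.2 fun e _ => X_ne_zero e
  | insert v A hv ih =>
    obtain ⟨p, hp⟩ := Nat.exists_eq_succ_of_ne_zero (hne v).card_ne_zero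
    rw [Nat.succ_eq_add_one] at hp
    let q := (E v).equivFinOfCardEq hp
    have hmem : ∀ c, (q.symm c : σ) ∈ E v := fun c => (q.symm c).2
    have hJ : eraseIdeal k (E v) = Ideal.span (Set.range (prodErase
        fun c => (X (q.symm c : σ) : MvPolynomial σ k))) := by
      rw [eraseIdeal]
      congr 1
      rw [← q.symm.surjective.range_comp]
      congr 1
      ext1 c
      rw [Function.comp_apply, prodErase]
      refine (Finset.prod_bij (fun c _ => (q.symm c : σ)) ?_ ?_ ?_ ?_).symm
      · intro c' hc'
        simpa [Subtype.val_inj] using hc'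
      · intro a _ b _ hab
        exact q.symm.injective (Subtype.val_injective hab)
      · intro e he
        refine ⟨q ⟨e, Finset.mem_of_mem_erase he⟩, ?_, by simp⟩
        refine Finset.mem_erase.2 ⟨fun h => Finset.ne_of_mem_erase he ?_, Finset.mem_univ _⟩
        rw [← h, q.symm_apply_apply]
      · intros
        rfl
    -- By disjointness none of the variables of `E v` occurs in the ideal built so far, so they are
    -- nonzerodivisors modulo it.
    have havoid : ∀ c, (Ideal.span {∏ e ∈ R, (X e : MvPolynomial σ k)} *
        ∏ v ∈ A, eraseIdeal k (E v)).IsMonomialAvoiding (q.symm c : σ) := by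
      intro c
      refine .mul ?_ (.prod fun w hw => ?_)
      · have := Ideal.isMonomialAvoiding_span_range_prod_X (k := k) (c := (q.symm c : σ))
          (fun _ : Unit => R) fun _ => Finset.disjoint_left.1 (hER v) (hmem c)
        simpa using this
      · refine Ideal.isMonomialAvoiding_span_range_prod_X _ fun e he => ?_
        refine Finset.disjoint_left.1 (hE ?_) (hmem c) (Finset.mem_of_mem_erase he)
        rintro rfl
        exact hv hw
    rw [Finset.prod_insert hv, mul_comm (eraseIdeal k _), ← mul_assoc, hJ]
    refine ih.mul_span_prodErase (fun c => X_prime) (fun c c' hcc' => not_X_dvd_X fun h =>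
      hcc' (q.symm.injective (Subtype.val_injective h))) (fun c => Ideal.subset_span ⟨_, rfl⟩)
      (fun c f hf => (havoid c).mem_of_X_mul_mem hf) ?_ ?_
    · rw [Finset.prod_insert hv, hp]
      simp [Polynomial.mul_coeff_zero]
    · intro i
      rw [Finset.prod_insert hv, hp, add_mul, mul_assoc, Polynomial.coeff_add,
        Polynomial.coeff_C_mul, Polynomial.coeff_C_mul, Polynomial.coeff_X_mul]
      simp

end MonomialIdeal

/-! ### Two expansions of the generating polynomial of the ranks -/

section Coefficients

open Polynomial

variable {ι : Type*} [Fintype ι]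

lemma coeff_prod_C_add_C_mul_X [DecidableEq ι] {R : Type*} [CommRing R] (a b : ι → R) (i : ℕ) :
    (∏ v, (C (a v) + C (b v) * X)).coeff i =
      ∑ A ∈ Finset.powersetCard i (Finset.univ : Finset ι), (∏ v ∈ A, b v) * ∏ v ∈ Aᶜ, a v := by
  have h : ∏ v, (C (a v) + C (b v) * X) =
      ∑ A : Finset ι, C ((∏ v ∈ A, b v) * ∏ v ∈ Aᶜ, a v) * X ^ A.card := by
    simp_rw [add_comm (C (a _)), Finset.prod_add, Finset.powerset_univ, Finset.prod_mul_distrib,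
      Finset.prod_const, ← Finset.compl_eq_univ_sdiff, C_mul, map_prod]
    exact Finset.sum_congr rfl fun _ _ => by ring
  rw [h, finsetSum_coeff]
  simp_rw [coeff_C_mul_X_pow]
  rw [← Finset.sum_filter]
  refine Finset.sum_congr ?_ fun _ _ => rfl
  ext A
  simp [eq_comm]

lemma natDegree_prod_C_add_C_mul_X_le {R : Type*} [CommSemiring R] (a b : ι → R) :
    (∏ v, (C (a v) + C (b v) * X)).natDegree ≤ Fintype.card ι := by
  refine (natDegree_prod_le _ _).trans ?_
  refine (Finset.sum_le_card_nsmul _ _ 1 fun v _ => ?_).trans (by simp)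
  rw [add_comm]
  exact natDegree_linear_le

/-- Both sides are the coefficient of `X ^ i` in `∏ (n v + (n v - 1) X) = ∏ (-X + n v (1 + X))`. In
the second form, the set `A` of factors contributing `-X` gives a multiple of `X ^ j * (1 + X) ^ (t
- j)` with `j = A.card`, whence the binomial coefficient. -/
lemma sum_powersetCard_prod_sub_one {t : ℕ} (n : Fin t → ℕ) {i : ℕ} (hi : i ≤ t) :
    ∑ A ∈ Finset.powersetCard i (Finset.univ : Finset (Fin t)),
        (∏ v ∈ A, ((n v : ℤ) - 1)) * ∏ v ∈ Aᶜ, (n v : ℤ) =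
      ∑ j ∈ Finset.range (i + 1),
        (-1) ^ j * ((t - j).choose (i - j) : ℤ) * (elemSymm n (t - j) : ℤ) := by
  have h : ∏ v, (C (n v : ℤ) + C ((n v : ℤ) - 1) * X) =
      ∑ A : Finset (Fin t), C ((-1) ^ A.card * ∏ v ∈ Aᶜ, (n v : ℤ)) *
        (X ^ A.card * (1 + X) ^ (t - A.card)) := by
    have h1 : ∀ v, C (n v : ℤ) + C ((n v : ℤ) - 1) * X = -X + C (n v : ℤ) * (1 + X) := fun v => by
      rw [C_sub, C_1]; ring
    simp_rw [h1, Finset.prod_add, Finset.powerset_univ, Finset.prod_mul_distrib,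
      Finset.prod_const, ← Finset.compl_eq_univ_sdiff, Finset.card_compl, Fintype.card_fin, C_mul,
      map_prod]
    refine Finset.sum_congr rfl fun A _ => ?_
    rw [neg_pow, C_pow, C_neg, C_1]
    ring
  rw [← coeff_prod_C_add_C_mul_X, h, finsetSum_coeff]
  have h2 : ∀ A : Finset (Fin t), (C ((-1) ^ A.card * ∏ v ∈ Aᶜ, (n v : ℤ)) *
      (X ^ A.card * (1 + X) ^ (t - A.card))).coeff i =
      if A.card ≤ i then (-1) ^ A.card * ((t - A.card).choose (i - A.card) : ℤ) *
        ∏ v ∈ Aᶜ, (n v : ℤ) else 0 := by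
    intro A
    rw [coeff_C_mul, coeff_X_pow_mul', coeff_one_add_X_pow]
    split_ifs
    · ring
    · simp
  simp_rw [h2]
  rw [← Finset.sum_filter, ← Finset.sum_fiberwise_of_maps_to (t := Finset.range (i + 1))
    (g := Finset.card) (fun A hA => by simpa [Nat.lt_succ_iff] using hA)]
  refine Finset.sum_congr rfl fun j hj => ?_
  have hj : j ≤ i := by simpa [Nat.lt_succ_iff] using hj
  rw [elemSymm, Nat.cast_sum, Finset.mul_sum]
  -- The products run over complements of `j`-sets, that is, over the `(t - j)`-sets.
  refine Finset.sum_bij' (fun A _ => Aᶜ) (fun A _ => Aᶜ) ?_ ?_ ?_ ?_ ?_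
  · intro A hA
    simp only [Finset.mem_filter] at hA
    simp [Finset.card_compl, hA.2]
  · intro A hA
    simp only [Finset.mem_powersetCard_univ] at hA
    simp only [Finset.mem_filter, Finset.mem_univ, true_and, Finset.card_compl, Fintype.card_fin]
    omega
  · simp
  · simp
  · intro A hA
    simp only [Finset.mem_filter] at hA
    simp [hA.2]

end Coefficients

/-! ### Cycles of a cactus are edge-disjoint -/

namespace Graph

variable {α β : Type*} {G H K C : Graph α β}

lemma forall_zmod_of_add_one {n : ℕ} (hn : n ≠ 0) {T : ZMod n → Prop} {a : ZMod n} (ha : T a)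
    (h : ∀ i, T i → T (i + 1)) (i : ZMod n) : T i := by
  have : NeZero n := ⟨hn⟩
  have key : ∀ j : ℕ, T (a + j) := by
    intro j
    induction j with
    | zero => simpa using ha
    | succ j ih => simpa [add_assoc] using h _ ih
  simpa using key (i - a).val

/-- Going around the cycle, one must pass from class `A` to class `B` and also back. The vertices `v
(i + 1)` and `v (j + 1)` of these two passages meet both classes, and they differ because `e i` and
`e j` lie in different classes. -/
lemma IsCycleOfLength.isNonseparable {n : ℕ} (hC : C.IsCycleOfLength n) : C.IsNonseparable := by
  obtain ⟨hn, v, e, hv, -, hV, hE, hl⟩ := hC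
  refine ⟨⟨⟨v 0, (hl 0).left_mem⟩, ?_⟩, ?_⟩
  · have h0 : ∀ i, Relation.ReflTransGen C.Adj (v 0) (v i) :=
      forall_zmod_of_add_one hn .refl fun i hi => hi.tail (hl i).adj
    rw [← hV]
    rintro _ ⟨i, rfl⟩ _ ⟨j, rfl⟩
    have hs : ∀ {x y}, Relation.ReflTransGen C.Adj x y → Relation.ReflTransGen C.Adj y x :=
      fun h => symm_of (Relation.ReflTransGen C.Adj) h
    exact (hs (h0 i)).trans (h0 j)
  · have key : ∀ A B : Set β, A.Nonempty → B.Nonempty → A ∪ B = E(C) → Disjoint A B →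
        ∃ i, e i ∈ A ∧ e (i + 1) ∈ B := by
      rintro A B ⟨a, ha⟩ ⟨b, hb⟩ hAB hd
      by_contra! hcon
      obtain ⟨i, rfl⟩ : a ∈ Set.range e := by rw [hE, ← hAB]; exact .inl ha
      obtain ⟨j, rfl⟩ : b ∈ Set.range e := by rw [hE, ← hAB]; exact .inr hb
      refine Set.disjoint_left.1 hd (forall_zmod_of_add_one (T := fun i => e i ∈ A) hn ha
        (fun l hl => ?_) j) hb
      have : e (l + 1) ∈ A ∪ B := by rw [hAB, ← hE]; exact ⟨_, rfl⟩
      exact this.resolve_right (hcon l hl)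
    rintro ⟨A, B, hA, hB, hd, hAB, hsub⟩
    obtain ⟨i, hiA, hiB⟩ := key A B hA hB hAB hd
    obtain ⟨j, hjB, hjA⟩ := key B A hB hA (by rw [Set.union_comm, hAB]) hd.symm
    have := hsub (x := v (i + 1)) ⟨⟨_, hiA, (hl i).inc_right⟩, _, hiB, (hl _).inc_left⟩
      (y := v (j + 1)) ⟨⟨_, hjA, (hl _).inc_left⟩, _, hjB, (hl j).inc_right⟩
    obtain rfl : i = j := by simpa using hv this
    exact Set.disjoint_left.1 hd hiA hjB

lemma IsCycleOfLength.edgeSet_nonempty {n : ℕ} (hC : C.IsCycleOfLength n) : E(C).Nonempty := by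
  obtain ⟨-, v, e, -, -, -, hE, -⟩ := hC
  exact hE ▸ ⟨e 0, 0, rfl⟩

lemma IsCycleOfLength.ncard_edgeSet {n : ℕ} (hC : C.IsCycleOfLength n) : E(C).ncard = n := by
  obtain ⟨-, v, e, -, he, -, hE, -⟩ := hC
  rw [← hE, ← Set.image_univ, Set.ncard_image_of_injective _ he, Set.ncard_univ, Nat.card_zmod]

/-- The incidence vectors of the edges of `H` sum to zero modulo two. At the vertex `v (i + 1)` of
`C` this sum only sees `e i` and `e (i + 1)`, so once `H` contains an edge of `C` it contains the
next one, and hence all of them. -/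
lemma IsCycleGraph.edgeSet_eq_of_le (hH : H.IsCycleGraph) (hC : C.IsCycleGraph) (hle : H ≤ C) :
    E(H) = E(C) := by
  classical
  obtain ⟨m, hH⟩ := hH
  obtain ⟨s, ⟨b, hb⟩, hs, hsum⟩ := hH.exists_sum_incVec hle
  obtain ⟨n, hn, v, e, hv, he, -, hE, hl⟩ := hC
  have : NeZero n := ⟨hn⟩
  refine (IsSubgraph.edgeSet_mono hle).antisymm ?_
  have hsE : ∀ f ∈ s, ∃ i, e i = f := fun f hf => by
    have : f ∈ E(H) := hs ▸ hf
    have := IsSubgraph.edgeSet_mono hle this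
    rwa [← hE] at this
  have himg : s = (Finset.univ.filter fun i => e i ∈ s).image e := by
    ext f
    simp only [Finset.mem_image, Finset.mem_filter, Finset.mem_univ, true_and]
    refine ⟨fun hf => ?_, ?_⟩
    · obtain ⟨i, rfl⟩ := hsE f hf
      exact ⟨i, hf, rfl⟩
    · rintro ⟨i, hi, rfl⟩
      exact hi
  have hstep : ∀ i, e i ∈ s → e (i + 1) ∈ s := by
    intro i hi
    rw [himg, Finset.sum_image fun a _ b _ h => he h] at hsum
    have h1 := DFunLike.congr_fun hsum (v (i + 1))
    simp only [fun j => (hl j).incVec_eq, Finsupp.finsetSum_apply, Finsupp.add_apply,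
      Finsupp.single_apply, hv.eq_iff, add_left_inj, Finset.sum_add_distrib,
      Finset.sum_ite_eq', Finset.mem_filter, Finset.mem_univ, true_and, Finsupp.coe_zero,
      Pi.zero_apply, if_pos hi] at h1
    by_contra hcon
    simp [hcon] at h1
  obtain ⟨j, rfl⟩ := hsE b hb
  rw [← hE, ← hs]
  rintro _ ⟨i, rfl⟩
  exact forall_zmod_of_add_one (T := fun i => e i ∈ s) hn hb hstep i

lemma IsCycleGraph.vertexSet_eq (hC : C.IsCycleGraph) (hle : C ≤ G) :
    V(C) = {x | ∃ e ∈ E(C), G.Inc e x} := by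
  obtain ⟨n, hn, v, e, -, -, hV, hE, hl⟩ := hC
  ext x
  constructor
  · rw [← hV]
    rintro ⟨i, rfl⟩
    exact ⟨e i, (hl i).edge_mem, (hl i).inc_left.mono hle⟩
  · rintro ⟨f, hf, hfx⟩
    exact ((IsSubgraph.inc_congr hle hf).2 hfx).vertex_mem

lemma IsNonseparable.exists_isBlock_ge (hV : V(G).Finite) (hE : E(G).Finite)
    (hH : H.IsNonseparable) (hle : H ≤ G) : ∃ B, G.IsBlock B ∧ H ≤ B := by
  -- A subgraph of `G` is determined by its vertex set and its edge set, so there are finitely many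
  -- and a maximal one exists.
  have hfin : {H : Graph α β | H ≤ G ∧ H.IsNonseparable}.Finite := by
    refine Set.Finite.of_finite_image (f := fun H => (V(H), E(H)))
      ((hV.finite_subsets.prod hE.finite_subsets).subset ?_) ?_
    · rintro _ ⟨K, ⟨hK, -⟩, rfl⟩
      exact ⟨IsSubgraph.vertexSet_mono hK, IsSubgraph.edgeSet_mono hK⟩
    · rintro K ⟨hK, -⟩ L ⟨hL, -⟩ hKL
      exact Compatible.ext (congr_arg Prod.fst hKL) (congr_arg Prod.snd hKL)
        (.of_le_le hK hL)
  obtain ⟨B, hHB, hB⟩ := hfin.exists_le_maximal ⟨hle, hH⟩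
  exact ⟨B, hB, hHB⟩

/-- Two nonseparable subgraphs with a common edge lie in a nonseparable subgraph. -/
lemma IsNonseparable.exists_ge_ge (hH : H.IsNonseparable) (hK : K.IsNonseparable) (hHG : H ≤ G)
    (hKG : K ≤ G) (hHK : (E(H) ∩ E(K)).Nonempty) :
    ∃ L ≤ G, L.IsNonseparable ∧ H ≤ L ∧ K ≤ L := by
  -- `L` is the union of `H` and `K`, formed inside `G`.
  let L := (G.restrict (E(H) ∪ E(K))).induce (V(H) ∪ V(K))
  have hL : ∀ {e x y}, L.IsLink e x y ↔ (G.IsLink e x y ∧ e ∈ E(H) ∪ E(K)) ∧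
      x ∈ V(H) ∪ V(K) ∧ y ∈ V(H) ∪ V(K) := by
    intro e x y
    simp [L]
    tauto
  have hHL : H ≤ L := ⟨fun x hx => .inl hx, fun e x y h =>
    hL.2 ⟨⟨h.mono hHG, .inl h.edge_mem⟩, .inl h.left_mem, .inl h.right_mem⟩⟩
  have hKL : K ≤ L := ⟨fun x hx => .inr hx, fun e x y h =>
    hL.2 ⟨⟨h.mono hKG, .inr h.edge_mem⟩, .inr h.left_mem, .inr h.right_mem⟩⟩
  have hLG : L ≤ G := (induce_le (by
    simpa using ⟨IsSubgraph.vertexSet_mono hHG, IsSubgraph.vertexSet_mono hKG⟩)).trans restrict_le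
  have hEL : E(L) = E(H) ∪ E(K) := by
    refine Set.Subset.antisymm (fun e he => ?_)
      (Set.union_subset (IsSubgraph.edgeSet_mono hHL) (IsSubgraph.edgeSet_mono hKL))
    obtain ⟨x, y, h⟩ := exists_isLink_of_mem_edgeSet he
    exact (hL.1 h).1.2
  obtain ⟨f, hfH, hfK⟩ := hHK
  refine ⟨L, hLG, ⟨⟨?_, ?_⟩, ?_⟩, hHL, hKL⟩
  · exact hH.1.1.mono (IsSubgraph.vertexSet_mono hHL)
  · obtain ⟨z, w, hz⟩ := exists_isLink_of_mem_edgeSet hfH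
    have hzK : z ∈ V(K) :=
      ((IsSubgraph.isLink_iff hKG hfK).2 (hz.mono hHG)).left_mem
    have hconn : ∀ x ∈ V(L), Relation.ReflTransGen L.Adj x z := by
      rintro x (hx | hx)
      · exact (hH.1.2 x hx z hz.left_mem).lift id fun _ _ h => Adj.mono hHL h
      · exact (hK.1.2 x hx z hzK).lift id fun _ _ h => Adj.mono hKL h
    have hs : ∀ {x y}, Relation.ReflTransGen L.Adj x y → Relation.ReflTransGen L.Adj y x :=
      fun h => symm_of (Relation.ReflTransGen L.Adj) h
    exact fun x hx y hy => (hconn x hx).trans (hs (hconn y hy))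
  -- A separation of `L` restricts to `H` and to `K`. As neither can be separated, each lies wholly
  -- in the class of the common edge `f`, which leaves the other class empty.
  · have key : ∀ A B : Set β, Disjoint A B → A ∪ B = E(L) →
        {x | (∃ e ∈ A, L.Inc e x) ∧ ∃ f ∈ B, L.Inc f x}.Subsingleton → f ∈ A →
        ∀ J : Graph α β, J.IsNonseparable → J ≤ L → f ∈ E(J) → E(J) ⊆ A := by
      intro A B hd hAB hsub hfA J hJ hJL hfJ
      by_contra hcon
      obtain ⟨g, hgJ, hgA⟩ := Set.not_subset.1 hcon
      have hgB : g ∈ B := by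
        have : g ∈ A ∪ B := hAB ▸ IsSubgraph.edgeSet_mono hJL hgJ
        exact this.resolve_left hgA
      refine hJ.2 ⟨A ∩ E(J), B ∩ E(J), ⟨f, hfA, hfJ⟩, ⟨g, hgB, hgJ⟩,
        hd.mono Set.inter_subset_left Set.inter_subset_left, ?_, hsub.anti ?_⟩
      · rw [← Set.union_inter_distrib_right, hAB]
        exact Set.inter_eq_self_of_subset_right (IsSubgraph.edgeSet_mono hJL)
      · rintro x ⟨⟨a, ha, hax⟩, b, hb, hbx⟩
        exact ⟨⟨a, ha.1, hax.mono hJL⟩, b, hb.1, hbx.mono hJL⟩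
    have key' : ∀ A B : Set β, B.Nonempty → Disjoint A B → A ∪ B = E(L) →
        {x | (∃ e ∈ A, L.Inc e x) ∧ ∃ f ∈ B, L.Inc f x}.Subsingleton → f ∉ A := by
      rintro A B ⟨b, hb⟩ hd hAB hsub hfA
      have hbL : b ∈ E(H) ∪ E(K) := by rw [← hEL, ← hAB]; exact .inr hb
      refine Set.disjoint_right.1 hd hb ?_
      rcases hbL with h | h
      · exact key A B hd hAB hsub hfA H hH hHL hfH h
      · exact key A B hd hAB hsub hfA K hK hKL hfK h
    rintro ⟨A, B, hA, hB, hd, hAB, hsub⟩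
    have hf : f ∈ A ∪ B := by rw [hAB, hEL]; exact .inl hfH
    rcases hf with h | h
    · exact key' A B hB hd hAB hsub h
    · refine key' B A hA hd.symm (by rw [Set.union_comm, hAB]) ?_ h
      simpa only [and_comm] using hsub

lemma IsCactus.disjoint_edgeSet (hG : G.IsCactus) (hHG : H ≤ G) (hKG : K ≤ G)
    (hH : H.IsCycleGraph) (hK : K.IsCycleGraph) (hne : H ≠ K) : Disjoint E(H) E(K) := by
  rw [Set.disjoint_iff_inter_eq_empty, ← Set.not_nonempty_iff_eq_empty]
  intro hHK
  obtain ⟨p, hp⟩ := id hH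
  obtain ⟨q, hq⟩ := id hK
  obtain ⟨L, hLG, hL, hHL, hKL⟩ :=
    hp.isNonseparable.exists_ge_ge hq.isNonseparable hHG hKG hHK
  obtain ⟨B, hB, hLB⟩ := hL.exists_isBlock_ge hG.finite_vertexSet hG.finite_edgeSet hLG
  have hE : E(H) = E(K) := by
    rcases hG.isCycle_or_edge_of_isBlock B hB with hc | ⟨e, he⟩
    · rw [hH.edgeSet_eq_of_le hc (hHL.trans hLB), hK.edgeSet_eq_of_le hc (hKL.trans hLB)]
    · have h1 := IsSubgraph.edgeSet_mono (hHL.trans hLB)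
      have h2 := IsSubgraph.edgeSet_mono (hKL.trans hLB)
      rw [he] at h1 h2
      rw [hp.edgeSet_nonempty.subset_singleton_iff.1 h1,
        hq.edgeSet_nonempty.subset_singleton_iff.1 h2]
  -- A cycle has no isolated vertices, so its edge set determines it as a subgraph of `G`.
  refine hne (Compatible.ext ?_ hE (.of_le_le hHG hKG))
  rw [hH.vertexSet_eq hHG, hK.vertexSet_eq hKG, hE]

end Graph

/-! ### Bases and facet ideal of a matroid with disjoint circuits -/

namespace Matroid

variable {β ι : Type*} {M : Matroid β}

/-- If the minimal dependent sets of a matroid are disjoint, its bases are the complements of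
their transversals. -/
lemma isBase_iff_exists_eq_diff_range {D : ι → Set β} (hD : Pairwise fun v w => Disjoint (D v) (D w))
    (hM : ∀ I, M.Indep I ↔ I ⊆ M.E ∧ ∀ v, ¬ D v ⊆ I) (hDE : ∀ v, D v ⊆ M.E) {B : Set β} :
    M.IsBase B ↔ ∃ c : ι → β, (∀ v, c v ∈ D v) ∧ B = M.E \ Set.range c := by
  have hindep : ∀ c : ι → β, (∀ v, c v ∈ D v) → M.Indep (M.E \ Set.range c) := fun c hc =>
    (hM _).2 ⟨Set.sdiff_subset, fun v h => (h (hc v)).2 ⟨v, rfl⟩⟩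
  rw [isBase_iff_maximal_indep]
  constructor
  · intro hB
    -- Each `D v` has an element that `B` misses; `B` is contained in the complement of these, which
    -- is independent, and maximality gives equality.
    choose c hcD hcB using fun v => Set.not_subset.1 (((hM B).1 hB.prop).2 v)
    refine ⟨c, hcD, hB.eq_of_subset (hindep c hcD) ?_⟩
    refine Set.subset_sdiff.2 ⟨((hM B).1 hB.prop).1, Set.disjoint_right.2 ?_⟩
    rintro _ ⟨v, rfl⟩
    exact hcB v
  · rintro ⟨c, hc, rfl⟩
    refine ⟨hindep c hc, fun I hI hle e he => ?_⟩
    refine ⟨((hM I).1 hI).1 he, ?_⟩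
    rintro ⟨v, rfl⟩
    -- If `I` contained the deleted element `c v`, it would contain all of `D v`, since by
    -- disjointness no other `c w` lies in `D v`.
    refine ((hM I).1 hI).2 v fun f hf => ?_
    by_cases hfc : f ∈ Set.range c
    · obtain ⟨w, rfl⟩ := hfc
      by_cases hvw : v = w
      · exact hvw ▸ he
      · exact absurd (hc w) (Set.disjoint_left.1 (hD hvw) hf)
    · exact hle ⟨hDE v hf, hfc⟩

-- The complement of a transversal `c` is the disjoint union of the elements outside every `D v` and
-- the sets `D v` without `c v`. Its monomial is thus a product of one generator from each factor,
-- and every such choice of generators comes from a transversal.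
open Pointwise in
lemma facetIdeal_eq (k : Type*) [Field k] [Fintype ι] [Fintype M.E] [DecidableEq M.E]
    {D : ι → Finset M.E} (hD : Pairwise fun v w => Disjoint (D v) (D w))
    (hB : ∀ B : Finset M.E, M.IsBase (Subtype.val '' (B : Set M.E)) ↔
      ∃ c : ι → M.E, (∀ v, c v ∈ D v) ∧ B = (Finset.univ.image c)ᶜ) :
    M.facetIdeal k = Ideal.span {∏ e ∈ (Finset.univ.biUnion D)ᶜ, MvPolynomial.X e} *
      ∏ v, eraseIdeal k (D v) := by
  classical
  have hprod : ∀ c : ι → M.E, (∀ v, c v ∈ D v) →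
      (∏ e ∈ (Finset.univ.image c)ᶜ, MvPolynomial.X e : MvPolynomial M.E k) =
      (∏ e ∈ (Finset.univ.biUnion D)ᶜ, MvPolynomial.X e) *
        ∏ v, ∏ e ∈ (D v).erase (c v), MvPolynomial.X e := by
    intro c hc
    rw [← Finset.prod_biUnion, ← Finset.prod_union]
    · refine Finset.prod_congr ?_ fun _ _ => rfl
      ext e
      simp only [Finset.mem_compl, Finset.mem_image, Finset.mem_univ, true_and, Finset.mem_union,
        Finset.mem_biUnion, Finset.mem_erase, not_exists]
      constructor
      · intro h
        by_cases he : ∃ v, e ∈ D v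
        · obtain ⟨v, hv⟩ := he
          exact .inr ⟨v, fun h' => h v h'.symm, hv⟩
        · exact .inl (not_exists.1 he)
      · rintro (h | ⟨v, hv, hvD⟩) w rfl
        · exact h w (hc w)
        · by_cases hvw : v = w
          · exact hv (by rw [hvw])
          · exact Finset.disjoint_left.1 (hD hvw) hvD (hc w)
    · rw [Finset.disjoint_left]
      intro e he
      simp only [Finset.mem_compl, Finset.mem_biUnion, Finset.mem_univ, true_and, not_exists] at he
      simp only [Finset.mem_biUnion, not_exists, not_and]
      exact fun v _ hv => he v (Finset.mem_of_mem_erase hv)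
    · intro v _ w _ hvw
      exact (hD hvw).mono (Finset.erase_subset _ _) (Finset.erase_subset _ _)
  simp only [facetIdeal, eraseIdeal]
  rw [Ideal.prod_span, Ideal.span_mul_span]
  congr 1
  ext q
  simp only [Set.mem_ofPred_eq, Set.singleton_mul, Set.mem_image, Set.mem_fintype_prod, hB]
  constructor
  · rintro ⟨B, ⟨c, hc, rfl⟩, rfl⟩
    exact ⟨_, ⟨fun v => ∏ e ∈ (D v).erase (c v), MvPolynomial.X e, fun v => ⟨⟨c v, hc v⟩, rfl⟩,
      rfl⟩, (hprod c hc).symm⟩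
  · rintro ⟨_, ⟨g, hg, rfl⟩, rfl⟩
    choose c hc using hg
    refine ⟨_, ⟨fun v => c v, fun v => (c v).2, rfl⟩, ?_⟩
    rw [hprod _ fun v => (c v).2]
    congr 1
    exact Finset.prod_congr rfl fun v _ => (hc v).symm

end Matroid

/-! ### The theorem for cactus graphs -/

lemma Graph.IsCactus.isBase_cycleMatroid_iff {α β ι : Type*} {G : Graph α β} (hG : G.IsCactus)
    {C : ι → Graph α β} (hCinj : Function.Injective C)
    (hC : ∀ H : Graph α β, (∃ v, C v = H) ↔ H ≤ G ∧ H.IsCycleGraph) {B : Set β} :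
    G.cycleMatroid.IsBase B ↔ ∃ c : ι → β, (∀ v, c v ∈ (C v).edgeSet) ∧ B = G.edgeSet \ Set.range c := by
  have hCv := fun v => (hC (C v)).1 ⟨v, rfl⟩
  refine Matroid.isBase_iff_exists_eq_diff_range (M := G.cycleMatroid)
    (fun v w hvw => hG.disjoint_edgeSet (hCv v).1 (hCv w).1 (hCv v).2 (hCv w).2 (hCinj.ne hvw))
    (fun I => and_congr_right fun _ => ⟨fun h v => h _ (hCv v).1 (hCv v).2, ?_⟩)
    fun v => Graph.IsSubgraph.edgeSet_mono (hCv v).1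
  rintro h H hHG hH
  obtain ⟨v, rfl⟩ := (hC H).2 ⟨hHG, hH⟩
  exact h v

theorem theorem5p1 {α β k : Type*} [Field k] (G : Graph α β) (hG : G.IsCactus)
    (t : ℕ) (ht : 1 ≤ t) (C : Fin t → Graph α β) (hCinj : Function.Injective C)
    (hC : ∀ H : Graph α β, (∃ v, C v = H) ↔ H ≤ G ∧ H.IsCycleGraph)
    (n : Fin t → ℕ) (hn : ∀ v, (C v).IsCycleOfLength (n v)) :
    ∃ b : ℕ → ℕ,
      HasMinimalFreeResolution (MvPolynomial.variableIdeal G.cycleMatroid.E k)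
        (Matroid.facetIdeal k G.cycleMatroid) b ∧
      (∀ i, t < i → b i = 0) ∧
      (∀ i ≤ t, (b i : ℤ) = ∑ j ∈ Finset.range (i + 1),
        (-1) ^ j * ((t - j).choose (i - j) : ℤ) * (elemSymm n (t - j) : ℤ)) ∧
      (∀ i ≤ t, (b i : ℤ) = ∑ A ∈ Finset.powersetCard i (Finset.univ : Finset (Fin t)),
        (∏ v ∈ A, ((n v : ℤ) - 1)) * ∏ v ∈ Aᶜ, (n v : ℤ)) := by
  classical
  have hCv := fun v => (hC (C v)).1 ⟨v, rfl⟩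
  have hfin : Fintype G.cycleMatroid.E := hG.finite_edgeSet.fintype
  -- The edges of `C v`, regarded as indices of the variables.
  let D : Fin t → Finset G.cycleMatroid.E := fun v => Finset.univ.filter fun e => e.1 ∈ (C v).edgeSet
  have hDmem : ∀ v e, e ∈ D v ↔ e.1 ∈ (C v).edgeSet := fun v e => Finset.mem_filter_univ e
  have hDcoe : ∀ v, Subtype.val '' (D v : Set G.cycleMatroid.E) = (C v).edgeSet := by
    intro v
    ext e
    simp only [Set.mem_image, Finset.mem_coe, hDmem, Subtype.exists, exists_and_left, exists_prop,
      exists_eq_right_right, and_iff_left_iff_imp]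
    exact fun he => Graph.IsSubgraph.edgeSet_mono (hCv v).1 he
  have hDcard : ∀ v, (D v).card = n v := fun v => by
    rw [← (hn v).ncard_edgeSet, ← hDcoe, Set.ncard_image_of_injective _ Subtype.val_injective,
      Set.ncard_coe_finset]
  have hDdisj : Pairwise fun v w => Disjoint (D v) (D w) := fun v w hvw => by
    refine Finset.disjoint_left.2 fun e he he' => ?_
    rw [hDmem] at he he'
    exact Set.disjoint_left.1 (hG.disjoint_edgeSet (hCv v).1 (hCv w).1 (hCv v).2 (hCv w).2
      (hCinj.ne hvw)) he he'
  have hn0 : ∀ v, n v ≠ 0 := fun v => (hn v).1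
  have hDne : ∀ v, (D v).Nonempty := fun v => by
    rw [← Finset.card_ne_zero, hDcard]
    exact hn0 v
  have hbase : ∀ B : Finset G.cycleMatroid.E,
      G.cycleMatroid.IsBase (Subtype.val '' (B : Set G.cycleMatroid.E)) ↔
      ∃ c : Fin t → G.cycleMatroid.E, (∀ v, c v ∈ D v) ∧ B = (Finset.univ.image c)ᶜ := by
    intro B
    have himg : ∀ c : Fin t → G.cycleMatroid.E,
        Subtype.val '' (((Finset.univ.image c)ᶜ : Finset G.cycleMatroid.E) :
          Set G.cycleMatroid.E) = G.edgeSet \ Set.range fun v => (c v).1 := by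
      intro c
      ext e
      simp only [Finset.coe_compl, Finset.coe_image, Finset.coe_univ, Set.image_univ,
        Set.mem_image, Set.mem_compl_iff, Set.mem_range, not_exists, Subtype.exists,
        exists_and_right, exists_eq_right, Set.mem_sdiff, Subtype.ext_iff]
      exact ⟨fun ⟨h1, h2⟩ => ⟨h1, h2⟩, fun ⟨h1, h2⟩ => ⟨h1, h2⟩⟩
    rw [hG.isBase_cycleMatroid_iff hCinj hC]
    constructor
    · rintro ⟨c, hc, hB⟩
      let c' : Fin t → G.cycleMatroid.E := fun v =>
        ⟨c v, Graph.IsSubgraph.edgeSet_mono (hCv v).1 (hc v)⟩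
      refine ⟨c', fun v => (hDmem _ _).2 (hc v), ?_⟩
      rw [← Finset.coe_inj]
      exact Set.image_injective.2 Subtype.val_injective (hB.trans (himg c').symm)
    · rintro ⟨c, hc, rfl⟩
      exact ⟨fun v => c v, fun v => (hDmem _ _).1 (hc v), himg c⟩
  have hres := hasMinimalResolution_prod_eraseIdeal (k := k) (Finset.univ.biUnion D)ᶜ D
    (fun v => disjoint_compl_right.mono_left
      (Finset.subset_biUnion_of_mem D (Finset.mem_univ v))) hDdisj hDne Finset.univ
  rw [← Matroid.facetIdeal_eq k hDdisj hbase] at hres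
  -- The ranks come from a polynomial over `ℕ` with truncated subtraction; as every cycle has length
  -- at least one, passing to `ℤ` turns it into genuine subtraction.
  have hcoeff : ∀ i, (((∏ v, (Polynomial.C (D v).card +
      Polynomial.C ((D v).card - 1) * Polynomial.X)).coeff i : ℕ) : ℤ) =
      ∑ A ∈ Finset.powersetCard i (Finset.univ : Finset (Fin t)),
        (∏ v ∈ A, ((n v : ℤ) - 1)) * ∏ v ∈ Aᶜ, (n v : ℤ) := by
    intro i
    rw [← coeff_prod_C_add_C_mul_X, ← eq_natCast (Nat.castRingHom ℤ), ← Polynomial.coeff_map,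
      Polynomial.map_prod]
    congr 1
    refine Finset.prod_congr rfl fun v _ => ?_
    have := Nat.one_le_iff_ne_zero.2 (hn0 v)
    rw [hDcard]
    simp [Nat.cast_sub this]
  refine ⟨_, hres.hasMinimalFreeResolution, fun i hi => ?_, fun i hi => ?_, fun i _ => hcoeff i⟩
  · refine Polynomial.coeff_eq_zero_of_natDegree_lt
      ((natDegree_prod_C_add_C_mul_X_le _ _).trans_lt ?_)
    simpa using hi
  · rw [hcoeff, sum_powersetCard_prod_sub_one n hi]
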